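/- Let $n\ge 0$ and let $A\in \mathrm{M}_n(\mathbb Z)$ with $\det A\neq 0$ and characteristic polynomial $h_A\in\mathbb Z[x]$. Let $X_A=\varprojlim_i \mathbb Z^n/A^i\mathbb Z^n$ be the associated $\mathbb Z^n$-odometer, with the inverse limit topology of the discrete groups $\mathbb Z^n/A^i\mathbb Z^n$ and the translation action of $\mathbb Z^n$. Let $\vec N(X_A)$ be its linear representation group: the group of all $T\in\mathrm{GL}_n(\mathbb Z)$ for which there is a homeomorphism $\varphi:X_A\to X_A$ with $\varphi(v\cdot x)=(Tv)\cdot\varphi(x)$ for all $v\in\mathbb Z^n$, $x\in X_A$. Let $\mathcal P(A)$ be the set of primes dividing $\det A$, let $\mathcal P'(A)=\{p\in\mathcal P(A) : h_A\not\equiv x^n \pmod p\}$, and for a prime $p$ let $t_p$ be the multiplicity of $0$ as a root of the reduction of $h_A$ modulo $p$. (1) If $\mathcal P(A)=\emptyset$ or $\mathcal P'(A)=\emptyset$, then $\vec N(X_A)=\mathrm{GL}_n(\mathbb Z)$. (2) Assume that $\mathcal P'(A)\neq\emptyset$, that $h_A$ is irreducible, and that there is a prime $p$ with $\gcd(n,t_p)=1$.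 Then $\vec N(X_A)$ is the centralizer of $A$ in $\mathrm{GL}_n(\mathbb Z)$, i.e. $\vec N(X_A)=\{T\in\mathrm{GL}_n(\mathbb Z): TA=AT\}$. Moreover, for every eigenvalue $\lambda\in\overline{\mathbb Q}$ of $A$, the group $\vec N(X_A)$ is isomorphic to a subgroup of the unit group $\mathcal O_K^\times$ of the ring of integers of $K=\mathbb Q(\lambda)$. Consequently, $\vec N(X_A)$ is a finitely generated abelian group, and if in addition $n=2$ and $h_A$ has no real roots, then $\vec N(X_A)$ is finite. -/

import Mathlib

namespace ZnOdometer

variable {n : ℕ}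

/-- The subgroup `G_i = A ^ i ℤⁿ` of `ℤⁿ`. -/
def latticeSeq (A : Matrix (Fin n) (Fin n) ℤ) (i : ℕ) : AddSubgroup (Fin n → ℤ) :=
  (A ^ i).mulVecLin.toAddMonoidHom.range

theorem latticeSeq_succ_le (A : Matrix (Fin n) (Fin n) ℤ) (i : ℕ) :
    latticeSeq A (i + 1) ≤ latticeSeq A i := by
  rintro _ ⟨x, rfl⟩
  exact ⟨A.mulVec x, by simp [pow_succ, Matrix.mulVec_mulVec]⟩

/-- The finite level `ℤⁿ / G_i` of the odometer. -/
abbrev Level (A : Matrix (Fin n) (Fin n) ℤ) (i : ℕ) : Type :=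
  (Fin n → ℤ) ⧸ latticeSeq A i

/-- The natural map `ℤⁿ / G_{i+1} → ℤⁿ / G_i`. -/
def levelMap (A : Matrix (Fin n) (Fin n) ℤ) (i : ℕ) : Level A (i + 1) →+ Level A i :=
  QuotientAddGroup.map (latticeSeq A (i + 1)) (latticeSeq A i) (AddMonoidHom.id _)
    (latticeSeq_succ_le A i)

/-- The odometer `X_A`, the inverse limit of the groups `ℤⁿ / A ^ i ℤⁿ` along the natural maps
(the level `i = 0` is a one-point space). -/
def Odometer (A : Matrix (Fin n) (Fin n) ℤ) : Type :=
  {x : ∀ i : ℕ, Level A i // ∀ i : ℕ, levelMap A i (x (i + 1)) = x i}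

/-- The inverse limit topology: each level has the quotient topology of the discrete group `ℤⁿ`
(so it is discrete), and `X_A` has the subspace topology of the product. -/
instance (A : Matrix (Fin n) (Fin n) ℤ) : TopologicalSpace (Odometer A) :=
  inferInstanceAs (TopologicalSpace
    {x : ∀ i : ℕ, Level A i // ∀ i : ℕ, levelMap A i (x (i + 1)) = x i})

/-- The natural action of `ℤⁿ` on `X_A`: translation by the class of `v` on every level. -/
instance (A : Matrix (Fin n) (Fin n) ℤ) : AddAction (Fin n → ℤ) (Odometer A) where
  vadd v x := ⟨fun i => (QuotientAddGroup.mk v : Level A i) + x.1 i, fun i => by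
    rw [map_add, x.2 i]; rfl⟩
  zero_vadd x := Subtype.ext (funext fun i => zero_add (x.1 i))
  add_vadd v w x := Subtype.ext (funext fun i =>
    add_assoc (QuotientAddGroup.mk v : Level A i) (QuotientAddGroup.mk w) (x.1 i))

/-- The linear representation group of `X_A`: all `T ∈ GL_n(ℤ)` for which there is a
self-homeomorphism `φ` of `X_A` with `φ (v · x) = (T v) · φ x` for all `v ∈ ℤⁿ`, `x ∈ X_A`. -/
def linRepGroup (A : Matrix (Fin n) (Fin n) ℤ) :
    Subgroup (Matrix.GeneralLinearGroup (Fin n) ℤ) where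
  carrier := {T | ∃ φ : Odometer A ≃ₜ Odometer A, ∀ (v : Fin n → ℤ) (x : Odometer A),
    φ (v +ᵥ x) = ((T : Matrix (Fin n) (Fin n) ℤ).mulVec v) +ᵥ φ x}
  one_mem' := ⟨Homeomorph.refl _, fun v x => by simp⟩
  mul_mem' := by
    rintro S T ⟨φ, hφ⟩ ⟨ψ, hψ⟩
    exact ⟨ψ.trans φ, fun v x => by simp [hφ, hψ, Matrix.mulVec_mulVec]⟩
  inv_mem' := by
    rintro T ⟨φ, hφ⟩
    refine ⟨φ.symm, fun v x => φ.injective ?_⟩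
    rw [hφ, Homeomorph.apply_symm_apply, Homeomorph.apply_symm_apply, Matrix.mulVec_mulVec,
      ← Units.val_mul, mul_inv_cancel, Units.val_one, Matrix.one_mulVec]

/-- `𝒫(A)`: the primes dividing `det A`. -/
def primesDet (A : Matrix (Fin n) (Fin n) ℤ) : Set ℕ :=
  {p | p.Prime ∧ (p : ℤ) ∣ A.det}

/-- `𝒫'(A)`: the primes `p ∈ 𝒫(A)` with `h_A ≢ x ^ n` modulo `p`. -/
def primesDet' (A : Matrix (Fin n) (Fin n) ℤ) : Set ℕ :=
  {p | p ∈ primesDet A ∧ A.charpoly.map (Int.castRingHom (ZMod p)) ≠ Polynomial.X ^ n}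

/-- `t_p`: the multiplicity of zero in the reduction of `h_A` modulo `p`. -/
noncomputable def zeroMult (A : Matrix (Fin n) (Fin n) ℤ) (p : ℕ) : ℕ :=
  (A.charpoly.map (Int.castRingHom (ZMod p))).rootMultiplicity 0

end ZnOdometer

namespace ZnOdometer

variable {n : ℕ}

/-! A matrix `T` lies in the linear representation group exactly when `T` and `T⁻¹` are continuous
for the topology on ℤⁿ with basis A^i ℤⁿ at 0. In case (1), A is nilpotent modulo every prime
dividing det A, so high powers of A are divisible by det(A^i), and every `T` is continuous. In case
(2), work in the ring of integers of a splitting field L of h_A. Let P be a prime above p, and let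
u_b, w_a be right and left eigenvectors. Continuity gives T A^j = A^i M, so λ_b^j (w_a T u_b) =
λ_a^i (w_a M u_b). If λ_a ∈ P and λ_b ∉ P, then w_a T u_b lies in every P^i and vanishes
(`dotProduct_mulVec_eq_zero`). The number of roots in P is t_p. Since gcd(n, t_p) = 1, Galois
conjugates of P realise this situation for every pair a ≠ b (`exists_smul_mem_and_notMem`). Hence
`T` is diagonal in an eigenbasis of A and commutes with A. The rational centralizer of A is ℚ[A] ≅
ℚ(λ), which yields the embedding into units; Dirichlet's unit theorem gives the rest. -/

instance (A : Matrix (Fin n) (Fin n) ℤ) (i : ℕ) : DiscreteTopology (Level A i) :=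
  QuotientAddGroup.discreteTopology (isOpen_discrete _)

/-- `T` is continuous for the topology on `ℤⁿ` given by the subgroups `A ^ i ℤⁿ`. -/
def ContinuousFor (A T : Matrix (Fin n) (Fin n) ℤ) : Prop :=
  ∀ i, ∃ j, ∀ v ∈ latticeSeq A j, T.mulVec v ∈ latticeSeq A i

/-! ### The odometer and its continuous linear maps -/

namespace Odometer

variable {A : Matrix (Fin n) (Fin n) ℤ}

theorem continuous_coord (i : ℕ) : Continuous fun x : Odometer A => x.1 i :=
  (continuous_apply i).comp continuous_subtype_val

theorem coord_of_le (x : Odometer A) {v : Fin n → ℤ} {i j : ℕ} (hij : i ≤ j)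
    (h : x.1 j = QuotientAddGroup.mk v) : x.1 i = QuotientAddGroup.mk v := by
  induction j, hij using Nat.le_induction with
  | base => exact h
  | succ k _ ih =>
    apply ih
    rw [← x.2 k, h]
    rfl

theorem vadd_coord (v : Fin n → ℤ) (x : Odometer A) (i : ℕ) :
    (v +ᵥ x).1 i = (QuotientAddGroup.mk v : Level A i) + x.1 i := rfl

theorem ext_coord {x y : Odometer A} (h : ∀ i, x.1 i = y.1 i) : x = y :=
  Subtype.ext (funext h)

/-- The point of the odometer given by the zero element of `ℤⁿ`. -/
def zeroPoint (A : Matrix (Fin n) (Fin n) ℤ) : Odometer A :=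
  ⟨fun _ => 0, fun _ => map_zero _⟩

/-- Cylinder sets form a basis of neighbourhoods. -/
theorem exists_level_of_mem_open {U : Set (Odometer A)} (hU : IsOpen U) {x : Odometer A}
    (hx : x ∈ U) : ∃ j, ∀ y : Odometer A, y.1 j = x.1 j → y ∈ U := by
  obtain ⟨V, hV, rfl⟩ := isOpen_induced_iff.1 hU
  obtain ⟨I, u, hu, huV⟩ := isOpen_pi_iff.1 hV x.1 hx
  refine ⟨I.sup id, fun y hy => huV fun i hi => ?_⟩
  have hle : i ≤ I.sup id := Finset.le_sup (f := id) hi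
  obtain ⟨v, hv⟩ := QuotientAddGroup.mk_surjective (x.1 (I.sup id))
  rw [coord_of_le y hle (hy.trans hv.symm), ← coord_of_le x hle hv.symm]
  exact (hu i hi).2

/-- The self-map of the odometer extending a continuous linear map. -/
noncomputable def lift {T : Matrix (Fin n) (Fin n) ℤ} (hT : ContinuousFor A T) (x : Odometer A) :
    Odometer A :=
  ⟨fun i => QuotientAddGroup.map (latticeSeq A (hT i).choose) (latticeSeq A i)
      T.mulVecLin.toAddMonoidHom (hT i).choose_spec (x.1 (hT i).choose), fun i => by
    -- The levels chosen for i and i + 1 need not be ordered; one representative at the larger level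
    -- computes both coordinates.
    obtain ⟨v, hv⟩ := QuotientAddGroup.mk_surjective
      (x.1 (max (hT i).choose (hT (i + 1)).choose))
    dsimp only
    rw [coord_of_le x (le_max_left _ _) hv.symm, coord_of_le x (le_max_right _ _) hv.symm]
    rfl⟩

theorem lift_coord {T : Matrix (Fin n) (Fin n) ℤ} (hT : ContinuousFor A T) (x : Odometer A)
    {v : Fin n → ℤ} {i : ℕ} (h : x.1 (hT i).choose = QuotientAddGroup.mk v) :
    (lift hT x).1 i = QuotientAddGroup.mk (T.mulVec v) := by
  change QuotientAddGroup.map _ _ _ _ _ = _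
  rw [h]
  rfl

theorem continuous_lift {T : Matrix (Fin n) (Fin n) ℤ} (hT : ContinuousFor A T) :
    Continuous (lift hT) :=
  Continuous.subtype_mk (continuous_pi fun _ =>
    continuous_of_discreteTopology.comp (continuous_coord _)) _

theorem lift_vadd {T : Matrix (Fin n) (Fin n) ℤ} (hT : ContinuousFor A T) (v : Fin n → ℤ)
    (x : Odometer A) : lift hT (v +ᵥ x) = T.mulVec v +ᵥ lift hT x := by
  refine ext_coord fun i => ?_
  obtain ⟨w, hw⟩ := QuotientAddGroup.mk_surjective (x.1 (hT i).choose)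
  rw [vadd_coord, lift_coord hT x hw.symm, lift_coord hT (v +ᵥ x) (v := v + w),
    Matrix.mulVec_add]
  · rfl
  · rw [vadd_coord, ← hw]
    rfl

theorem lift_lift {S T : Matrix (Fin n) (Fin n) ℤ} (hS : ContinuousFor A S)
    (hT : ContinuousFor A T) (h : S * T = 1) (x : Odometer A) : lift hS (lift hT x) = x := by
  refine ext_coord fun i => ?_
  obtain ⟨v, hv⟩ := QuotientAddGroup.mk_surjective
    (x.1 (max i (hT (hS i).choose).choose))
  rw [lift_coord hS (lift hT x) (lift_coord hT x (coord_of_le x (le_max_right _ _) hv.symm)),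
    coord_of_le x (le_max_left _ _) hv.symm, Matrix.mulVec_mulVec, h, Matrix.one_mulVec]

end Odometer

/-- By equivariance φ(v + 0) = Tv + φ(0), so continuity of φ at the zero point is continuity of `T`
at 0, after cancelling φ(0). -/
theorem continuousFor_of_mem_linRepGroup {A : Matrix (Fin n) (Fin n) ℤ}
    {T : Matrix.GeneralLinearGroup (Fin n) ℤ} (hT : T ∈ linRepGroup A) :
    ContinuousFor A (T : Matrix (Fin n) (Fin n) ℤ) := by
  obtain ⟨φ, hφ⟩ := hT
  intro i
  let x := Odometer.zeroPoint A
  have hU : IsOpen {y | (φ y).1 i = (φ x).1 i} :=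
    (isOpen_discrete {(φ x).1 i}).preimage
      ((Odometer.continuous_coord i).comp φ.continuous)
  obtain ⟨j, hj⟩ := Odometer.exists_level_of_mem_open hU (x := x) rfl
  refine ⟨j, fun v hv => ?_⟩
  have h := hj (v +ᵥ x) (by
    rw [Odometer.vadd_coord, (QuotientAddGroup.eq_zero_iff v).2 hv, zero_add])
  rw [Set.mem_ofPred_eq, hφ, Odometer.vadd_coord, add_eq_right] at h
  exact (QuotientAddGroup.eq_zero_iff _).1 h

theorem mem_linRepGroup_of_continuousFor {A : Matrix (Fin n) (Fin n) ℤ}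
    {T : Matrix.GeneralLinearGroup (Fin n) ℤ}
    (hT : ContinuousFor A (T : Matrix (Fin n) (Fin n) ℤ))
    (hT' : ContinuousFor A ((T⁻¹ : Matrix.GeneralLinearGroup (Fin n) ℤ) :
      Matrix (Fin n) (Fin n) ℤ)) : T ∈ linRepGroup A :=
  ⟨{  toFun := Odometer.lift hT
      invFun := Odometer.lift hT'
      left_inv := Odometer.lift_lift hT' hT (by rw [← Units.val_mul, inv_mul_cancel, Units.val_one])
      right_inv := Odometer.lift_lift hT hT'
        (by rw [← Units.val_mul, mul_inv_cancel, Units.val_one])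
      continuous_toFun := Odometer.continuous_lift hT
      continuous_invFun := Odometer.continuous_lift hT' }, Odometer.lift_vadd hT⟩

theorem continuousFor_of_commute {A T : Matrix (Fin n) (Fin n) ℤ} (h : Commute T A) :
    ContinuousFor A T := fun i => ⟨i, by
  rintro _ ⟨w, rfl⟩
  refine ⟨T.mulVec w, ?_⟩
  simp [Matrix.mulVec_mulVec, (h.pow_right i).eq]⟩

theorem mem_linRepGroup_of_commute {A : Matrix (Fin n) (Fin n) ℤ}
    {T : Matrix.GeneralLinearGroup (Fin n) ℤ} (h : Commute (T : Matrix (Fin n) (Fin n) ℤ) A) :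
    T ∈ linRepGroup A :=
  mem_linRepGroup_of_continuousFor (continuousFor_of_commute h)
    (continuousFor_of_commute h.units_inv_left)

/-- If `T` is continuous then `T * A ^ j` factors through `A ^ i`. -/
theorem ContinuousFor.exists_factor {A T : Matrix (Fin n) (Fin n) ℤ} (h : ContinuousFor A T)
    (i : ℕ) : ∃ j M, T * A ^ j = A ^ i * M := by
  obtain ⟨j, hj⟩ := h i
  have h' : ∀ k, ∃ w, (A ^ i).mulVec w = (T * A ^ j).col k := fun k => by
    obtain ⟨w, hw⟩ := hj _ ⟨Pi.single k 1, rfl⟩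
    refine ⟨w, hw.trans ?_⟩
    change T.mulVec ((A ^ j).mulVec (Pi.single k 1)) = _
    rw [Matrix.mulVec_mulVec, Matrix.mulVec_single_one]
  choose w hw using h'
  refine ⟨j, Matrix.of fun a k => w k a, ?_⟩
  ext a k
  exact (congrFun (hw k) a).symm

/-! ### Nilpotent reductions: the case of the full group -/

theorem pow_charpoly_map_eq_zero {A : Matrix (Fin n) (Fin n) ℤ} {p : ℕ}
    (h : A.charpoly.map (Int.castRingHom (ZMod p)) = Polynomial.X ^ n) (a b : Fin n) :
    (p : ℤ) ∣ (A ^ n) a b := by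
  have h1 := Matrix.aeval_self_charpoly (A.map (Int.castRingHom (ZMod p)))
  rw [Matrix.charpoly_map, h, map_pow, Polynomial.aeval_X, ← Matrix.map_pow] at h1
  have := congrFun (congrFun h1 a) b
  rw [← ZMod.intCast_zmod_eq_zero_iff_dvd]
  exact this

/-- Multiply along the prime factorization of m: if r divides A^j and s divides A^k entrywise, then
rs divides A^(j+k). -/
theorem exists_pow_dvd {A : Matrix (Fin n) (Fin n) ℤ} {m : ℕ} (hm : m ≠ 0)
    (h : ∀ p : ℕ, p.Prime → p ∣ m →
      A.charpoly.map (Int.castRingHom (ZMod p)) = Polynomial.X ^ n) :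
    ∃ j, ∀ a b, (m : ℤ) ∣ (A ^ j) a b := by
  induction m using Nat.recOnMul with
  | zero => exact absurd rfl hm
  | one => exact ⟨0, by simp⟩
  | prime p hp => exact ⟨n, pow_charpoly_map_eq_zero (h p hp dvd_rfl)⟩
  | mul r s hr hs =>
    obtain ⟨j, hj⟩ := hr (left_ne_zero_of_mul hm) fun p hp hd => h p hp (hd.mul_right s)
    obtain ⟨k, hk⟩ := hs (right_ne_zero_of_mul hm) fun p hp hd => h p hp (hd.mul_left r)
    refine ⟨j + k, fun a b => ?_⟩
    rw [pow_add, Matrix.mul_apply, Nat.cast_mul]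
    exact Finset.dvd_sum fun c _ => mul_dvd_mul (hj a c) (hk c b)

theorem smul_mem_latticeSeq (A : Matrix (Fin n) (Fin n) ℤ) (i : ℕ) (v : Fin n → ℤ) :
    (A ^ i).det • v ∈ latticeSeq A i := by
  refine ⟨(A ^ i).adjugate.mulVec v, ?_⟩
  change (A ^ i).mulVec ((A ^ i).adjugate.mulVec v) = _
  rw [Matrix.mulVec_mulVec, Matrix.mul_adjugate, Matrix.smul_mulVec, Matrix.one_mulVec]

/-- Some A^j is divisible by d = det(A^i), so T A^j ℤⁿ ⊆ d ℤⁿ ⊆ A^i ℤⁿ, the last inclusion by the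
adjugate. -/
theorem continuousFor_of_primesDet'_eq_empty {A : Matrix (Fin n) (Fin n) ℤ} (hA : A.det ≠ 0)
    (h : primesDet' A = ∅) (T : Matrix (Fin n) (Fin n) ℤ) : ContinuousFor A T := by
  intro i
  have hdet : (A ^ i).det.natAbs ≠ 0 := by simp [hA]
  obtain ⟨j, hj⟩ := exists_pow_dvd (A := A) hdet fun p hp hd => by
    by_contra hne
    have hmem : p ∈ primesDet' A := by
      refine ⟨⟨hp, ?_⟩, hne⟩
      rw [← Int.natCast_dvd, Matrix.det_pow] at hd
      exact (Nat.prime_iff_prime_int.1 hp).dvd_of_dvd_pow hd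
    rw [h] at hmem
    exact hmem
  refine ⟨j, ?_⟩
  rintro _ ⟨w, rfl⟩
  have hd' : ∀ a, (A ^ i).det ∣ (A ^ j).mulVec w a := fun a => by
    rw [Matrix.mulVec, dotProduct]
    exact Finset.dvd_sum fun c _ => Dvd.dvd.mul_right (Int.natAbs_dvd.1 (hj a c)) _
  have hd : ∀ a, (A ^ i).det ∣ T.mulVec ((A ^ j).mulVec w) a := fun a => by
    rw [Matrix.mulVec, dotProduct]
    exact Finset.dvd_sum fun b _ => Dvd.dvd.mul_left (hd' b) _
  choose v hv using hd
  have : T.mulVec ((A ^ j).mulVec w) = (A ^ i).det • v := funext hv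
  change T.mulVec ((A ^ j).mulVec w) ∈ _
  rw [this]
  exact smul_mem_latticeSeq A i v

theorem linRepGroup_eq_top {A : Matrix (Fin n) (Fin n) ℤ} (hA : A.det ≠ 0)
    (h : primesDet A = ∅ ∨ primesDet' A = ∅) : linRepGroup A = ⊤ := by
  have h' : primesDet' A = ∅ :=
    h.elim (fun h => Set.subset_empty_iff.1 (h ▸ fun _ hp => hp.1)) id
  exact (Subgroup.eq_top_iff' _).2 fun T => mem_linRepGroup_of_continuousFor
    (continuousFor_of_primesDet'_eq_empty hA h' _) (continuousFor_of_primesDet'_eq_empty hA h' _)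

/-! ### Separating points by translates of a set -/

/-- If a finite transitive action on `ι` and the subset `Z` have coprime cardinalities,
then the translates of `Z` separate the points of `ι`. -/
theorem exists_smul_mem_and_notMem {G ι : Type*} [Group G] [MulAction G ι]
    [MulAction.IsPretransitive G ι] [Fintype ι] (Z : Finset ι)
    (hZ : Nat.gcd (Fintype.card ι) Z.card = 1) {a b : ι} (hab : a ≠ b) :
    ∃ g : G, g • b ∈ Z ∧ g • a ∉ Z := by
  classical
  by_contra! hcon
  -- `B x` is the intersection of all translates of `Z` containing x. These sets have equal size by
  -- transitivity and partition ι, and `Z` is a union of them. Their size divides both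
  -- cardinalities, hence is 1, whereas non-separation puts a in `B b`.
  let B : ι → Finset ι := fun x => {y | ∀ g : G, g • x ∈ Z → g • y ∈ Z}
  have mem_B : ∀ {x y}, y ∈ B x ↔ ∀ g : G, g • x ∈ Z → g • y ∈ Z := by simp [B]
  have card_B : ∀ x, (B x).card = (B b).card := fun x => by
    obtain ⟨g, rfl⟩ := MulAction.exists_smul_eq G b x
    refine (Finset.card_bij' (fun y _ => g • y) (fun y _ => g⁻¹ • y) ?_ ?_ ?_ ?_).symm
    · intro y hy
      refine mem_B.2 fun k hk => ?_
      rw [← mul_smul] at hk ⊢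
      exact mem_B.1 hy _ hk
    · intro y hy
      refine mem_B.2 fun k hk => ?_
      rw [← mul_smul]
      exact mem_B.1 hy _ (by rwa [mul_smul, inv_smul_smul])
    · intro y _; exact inv_smul_smul g y
    · intro y _; exact smul_inv_smul g y
  have self_mem : ∀ x, x ∈ B x := fun x => mem_B.2 fun _ h => h
  have B_eq : ∀ {x y}, y ∈ B x → B y = B x := fun {x y} hy =>
    Finset.eq_of_subset_of_card_le
      (fun z hz => mem_B.2 fun g hg => mem_B.1 hz g (mem_B.1 hy g hg))
      ((card_B x).trans (card_B y).symm).le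
  have dvd_card : ∀ W : Finset ι, (∀ x ∈ W, B x ⊆ W) → (B b).card ∣ W.card := fun W hW => by
    rw [Finset.card_eq_sum_card_image B W]
    refine Finset.dvd_sum fun C hC => ?_
    obtain ⟨x, hx, rfl⟩ := Finset.mem_image.1 hC
    have : W.filter (fun y => B y = B x) = B x := by
      ext y
      rw [Finset.mem_filter]
      exact ⟨fun h => h.2 ▸ self_mem y, fun h => ⟨hW x hx h, B_eq h⟩⟩
    rw [this, card_B x]
  have h1 : (B b).card ∣ 1 := hZ ▸ Nat.dvd_gcd
    (dvd_card Finset.univ fun _ _ => Finset.subset_univ _)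
    (dvd_card Z fun x hx y hy => by simpa using mem_B.1 hy 1 (by simpa using hx))
  have h2 : 1 < (B b).card := Finset.one_lt_card.2 ⟨a, mem_B.2 hcon, b, self_mem b, hab⟩
  exact absurd (Nat.le_of_dvd one_pos h1) (not_le.2 h2)

/-! ### Eigenvectors and P-adic divisibility -/

theorem dotProduct_mulVec_eq_zero {O : Type*} [CommRing O] [IsDedekindDomain O]
    {A T : Matrix (Fin n) (Fin n) ℤ} (hT : ContinuousFor A T) (P : Ideal O) [P.IsPrime]
    {l m : O} (hl : l ∉ P) (hm : m ∈ P) {u w : Fin n → O}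
    (hu : (A.map (Int.castRingHom O)).mulVec u = l • u)
    (hw : Matrix.vecMul w (A.map (Int.castRingHom O)) = m • w) :
    w ⬝ᵥ (T.map (Int.castRingHom O)).mulVec u = 0 := by
  have hu' : ∀ j : ℕ, ((A.map (Int.castRingHom O)) ^ j).mulVec u = l ^ j • u := fun j => by
    induction j with
    | zero => simp
    | succ j ih =>
      rw [pow_succ', ← Matrix.mulVec_mulVec, ih, Matrix.mulVec_smul, hu, smul_smul, pow_succ]
  have hw' : ∀ j : ℕ, Matrix.vecMul w ((A.map (Int.castRingHom O)) ^ j) = m ^ j • w := fun j => by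
    induction j with
    | zero => simp
    | succ j ih =>
      rw [pow_succ, ← Matrix.vecMul_vecMul, ih, Matrix.smul_vecMul, hw, smul_smul, pow_succ]
  have hmem : ∀ i : ℕ, w ⬝ᵥ (T.map (Int.castRingHom O)).mulVec u ∈ P ^ i := fun i => by
    obtain ⟨j, M, h⟩ := hT.exists_factor i
    have h' := congrArg (fun N => w ⬝ᵥ (N.map (Int.castRingHom O)).mulVec u) h
    simp only [Matrix.map_mul, Matrix.map_pow] at h'
    rw [← Matrix.mulVec_mulVec, hu', Matrix.mulVec_smul, dotProduct_smul,
      ← Matrix.mulVec_mulVec, Matrix.dotProduct_mulVec w (_ ^ i), hw', smul_dotProduct, smul_eq_mul,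
      smul_eq_mul] at h'
    have h3 : l ^ j * (w ⬝ᵥ (T.map (Int.castRingHom O)).mulVec u) ∈ P ^ i := by
      rw [h']
      exact Ideal.mul_mem_right _ _ (Ideal.pow_mem_pow hm i)
    -- In a Dedekind domain a factor outside P can be cancelled from membership in P^i; here the
    -- factor is l^j.
    exact (Ideal.IsPrime.mul_mem_pow P h3).resolve_left
      fun hh => hl (Ideal.IsPrime.mem_of_pow_mem ‹_› j hh)
  have hinf := Ideal.iInf_pow_eq_bot_of_isDomain P (Ideal.IsPrime.ne_top ‹_›)
  exact (Ideal.mem_bot.1 (hinf ▸ Ideal.mem_iInf.2 hmem))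

theorem det_ne_zero_of_eigenvectors {O : Type*} [CommRing O] [IsDomain O]
    {B U : Matrix (Fin n) (Fin n) O} {l : Fin n → O} (hl : Function.Injective l)
    (hU : ∀ i, U i ≠ 0) (h : ∀ i, B.mulVec (U i) = l i • U i) : U.det ≠ 0 := by
  have hli : LinearIndependent O U :=
    Module.End.eigenvectors_linearIndependent' B.mulVecLin l hl U fun i =>
      Module.End.hasEigenvector_iff.2 ⟨Module.End.mem_eigenspace_iff.2 (h i), hU i⟩
  intro hdet
  obtain ⟨v, hv, hv0⟩ := Matrix.exists_vecMul_eq_zero_iff.2 hdet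
  rw [Matrix.vecMul_eq_sum] at hv0
  exact hv (funext (Fintype.linearIndependent_iff.1 hli v hv0))

/-- If `x ↦ w ⬝ᵥ T x` pairs distinct eigenvectors of `A` to zero then `T` commutes with `A`. -/
theorem commute_of_dotProduct_eq_zero {O : Type*} [CommRing O] [IsDomain O]
    {A T : Matrix (Fin n) (Fin n) O} {l : Fin n → O} (hl : Function.Injective l)
    {U W : Matrix (Fin n) (Fin n) O} (hU0 : ∀ i, U i ≠ 0) (hW0 : ∀ i, W i ≠ 0)
    (hU : ∀ i, A.mulVec (U i) = l i • U i) (hW : ∀ i, Matrix.vecMul (W i) A = l i • W i)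
    (h : ∀ i j, i ≠ j → W i ⬝ᵥ T.mulVec (U j) = 0) : Commute T A := by
  have hUdet := det_ne_zero_of_eigenvectors hl hU0 hU
  have hWdet := det_ne_zero_of_eigenvectors (B := A.transpose) hl hW0
    fun i => (Matrix.mulVec_transpose _ _).trans (hW i)
  -- The pairing equals (l_j - l_i) w_i T u_j, so one of the two factors vanishes.
  have hz : ∀ i j, W i ⬝ᵥ (T * A - A * T).mulVec (U j) = 0 := fun i j => by
    rw [Matrix.sub_mulVec, dotProduct_sub, ← Matrix.mulVec_mulVec, hU, Matrix.mulVec_smul,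
      ← Matrix.mulVec_mulVec, Matrix.dotProduct_mulVec (W i) A, hW, dotProduct_smul,
      smul_dotProduct]
    by_cases hij : i = j
    · rw [hij, sub_self]
    · rw [h i j hij, smul_zero, smul_zero, sub_zero]
  have hz' : ∀ j, (T * A - A * T).mulVec (U j) = 0 := fun j =>
    Matrix.eq_zero_of_mulVec_eq_zero hWdet (funext fun i => hz i j)
  have hrow : ∀ i, (T * A - A * T) i = 0 := fun i =>
    Matrix.eq_zero_of_mulVec_eq_zero hUdet (funext fun j => by
      rw [Matrix.mulVec, dotProduct_comm]
      exact congrFun (hz' j) i)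
  exact sub_eq_zero.1 (funext hrow)

-- O/P is a domain of characteristic p, so ZMod p embeds in it without changing the multiplicity of
-- 0; there the polynomial splits, and its zero roots come from the r_i in P.
open Polynomial in
theorem rootMultiplicity_zero_eq_card {O ι : Type*} [CommRing O] [Fintype ι] (f : ℤ[X])
    (r : ι → O) (hf : f.map (Int.castRingHom O) = ∏ i, (X - C (r i))) {p : ℕ} (hp : p.Prime)
    (P : Ideal O) [P.IsPrime] (hpP : (p : O) ∈ P) [DecidablePred fun i => r i ∈ P] :
    (f.map (Int.castRingHom (ZMod p))).rootMultiplicity 0 =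
      (Finset.univ.filter fun i => r i ∈ P).card := by
  classical
  have := Fact.mk hp
  have : CharP (O ⧸ P) p := (CharP.charP_iff_prime_eq_zero hp).2 (by
    rw [← map_natCast (Ideal.Quotient.mk P)]
    exact Ideal.Quotient.eq_zero_iff_mem.2 hpP)
  have hmap : (f.map (Int.castRingHom (ZMod p))).map (ZMod.castHom dvd_rfl (O ⧸ P)) =
      ∏ i, (X - C (Ideal.Quotient.mk P (r i))) := by
    rw [Polynomial.map_map, RingHom.ext_int ((ZMod.castHom dvd_rfl (O ⧸ P)).comp
      (Int.castRingHom (ZMod p))) ((Ideal.Quotient.mk P).comp (Int.castRingHom O)),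
      ← Polynomial.map_map, hf, Polynomial.map_prod]
    simp
  rw [eq_rootMultiplicity_map (ZMod.castHom dvd_rfl (O ⧸ P)).injective, hmap, map_zero,
    ← count_roots]
  rw [roots_prod _ _ (Finset.prod_ne_zero_iff.2 fun i _ => X_sub_C_ne_zero _)]
  simp only [roots_X_sub_C]
  rw [Multiset.count_bind, Finset.card_filter]
  change (Multiset.map _ _).sum = Finset.sum _ _
  refine congrArg _ (Multiset.map_congr rfl fun i _ => ?_)
  simp [Multiset.count_singleton, eq_comm, ← Ideal.Quotient.eq_zero_iff_mem]

open Polynomial in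
theorem map_eq_prod_rootSet {F E : Type*} [Field F] [Field E] [Algebra F E] {q : F[X]}
    (hm : q.Monic) (hsep : q.Separable) (hs : (q.map (algebraMap F E)).Splits) :
    q.map (algebraMap F E) = ∏ x : q.rootSet E, (X - C (x : E)) := by
  classical
  have hnd : (q.map (algebraMap F E)).roots.Nodup := nodup_roots hsep.map
  conv_lhs => rw [hs.eq_prod_roots_of_monic (hm.map _)]
  rw [Finset.prod_set_coe (f := fun x : E => X - C x), show (q.rootSet E).toFinset =
      (q.map (algebraMap F E)).roots.toFinset by
        ext x
        rw [Set.mem_toFinset, Multiset.mem_toFinset, mem_rootSet, ← mem_aroots, aroots],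
    Finset.prod, Multiset.toFinset_val, hnd.dedup]

/-! ### Galois action on the eigenvalues -/

open Polynomial NumberField in
theorem commute_of_continuousFor_of_splits (L : Type*) [Field L] [NumberField L] [Algebra ℚ L]
    [Normal ℚ L]
    {A T : Matrix (Fin n) (Fin n) ℤ} (hirr : Irreducible A.charpoly)
    (hsplit : ((A.charpoly.map (algebraMap ℤ ℚ)).map (algebraMap ℚ L)).Splits) {p : ℕ}
    (hp : p.Prime) (hgcd : Nat.gcd n (zeroMult A p) = 1) (hT : ContinuousFor A T) :
    Commute T A := by
  classical
  let q : ℚ[X] := A.charpoly.map (algebraMap ℤ ℚ)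
  have hmonic : A.charpoly.Monic := A.charpoly_monic
  have hq : Irreducible q := hmonic.irreducible_iff_irreducible_map_fraction_map.1 hirr
  have hmapL : ∀ x : L, aeval x q = aeval x A.charpoly := fun x => aeval_map_algebraMap ℚ x _
  let r : q.rootSet L → 𝓞 L := fun x => ⟨x, A.charpoly, hmonic, by
    rw [← aeval_def, ← hmapL]
    exact (mem_rootSet.1 x.2).2⟩
  have hr : Function.Injective r := fun x y h => Subtype.ext (congrArg (algebraMap (𝓞 L) L) h)
  have hprod : A.charpoly.map (Int.castRingHom (𝓞 L)) = ∏ i, (X - C (r i)) := by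
    apply map_injective (algebraMap (𝓞 L) L) RingOfIntegers.coe_injective
    have h := map_eq_prod_rootSet (E := L) (hmonic.map _) hq.separable hsplit
    rw [Polynomial.map_map] at h
    rw [Polynomial.map_map, RingHom.ext_int ((algebraMap (𝓞 L) L).comp (Int.castRingHom (𝓞 L)))
      ((algebraMap ℚ L).comp (algebraMap ℤ ℚ)), h, Polynomial.map_prod]
    refine Finset.prod_congr rfl fun i _ => ?_
    rw [Polynomial.map_sub, map_X, map_C]
    rfl
  have hcard : Fintype.card (q.rootSet L) = n := by
    rw [card_rootSet_eq_natDegree hq.separable hsplit, hmonic.natDegree_map,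
      A.charpoly_natDegree_eq_dim, Fintype.card_fin]
  let A' := A.map (Int.castRingHom (𝓞 L))
  have hroot : ∀ i, (Matrix.scalar (Fin n) (r i) - A').det = 0 := fun i => by
    rw [← Matrix.eval_charpoly, Matrix.charpoly_map, hprod, eval_prod]
    exact Finset.prod_eq_zero (Finset.mem_univ i) (by simp)
  choose u hu0 hu using fun i => Matrix.exists_mulVec_eq_zero_iff.2 (hroot i)
  choose w hw0 hw using fun i => Matrix.exists_vecMul_eq_zero_iff.2 (hroot i)
  have hu' : ∀ i, A'.mulVec (u i) = r i • u i := fun i => by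
    have h := hu i
    rw [Matrix.sub_mulVec, sub_eq_zero] at h
    rw [← h]
    simp [← Matrix.smul_one_eq_diagonal, Matrix.smul_mulVec]
  have hw' : ∀ i, Matrix.vecMul (w i) A' = r i • w i := fun i => by
    have h := hw i
    rw [Matrix.vecMul_sub, sub_eq_zero] at h
    rw [← h]
    simp [← Matrix.smul_one_eq_diagonal, Matrix.vecMul_smul]
  obtain ⟨P, hPmax, hP⟩ := Ideal.exists_ideal_over_maximal_of_isIntegral (S := 𝓞 L)
    (P_max := have := Fact.mk hp; Int.ideal_span_isMaximal_of_prime p) (Ideal.span {(p : ℤ)}) (by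
      rw [(RingHom.injective_iff_ker_eq_bot _).1 (FaithfulSMul.algebraMap_injective ℤ (𝓞 L))]
      exact bot_le)
  have hpP : (p : 𝓞 L) ∈ P := by
    have : (p : ℤ) ∈ P.comap (algebraMap ℤ (𝓞 L)) := hP ▸ Ideal.mem_span_singleton_self _
    simpa using this
  have hPprime : P.IsPrime := hPmax.isPrime
  let Z : Finset (q.rootSet L) := {i | r i ∈ P}
  have hZ : zeroMult A p = Z.card := rootMultiplicity_zero_eq_card _ r hprod hp P hpP
  let _ : MulAction (L ≃ₐ[ℚ] L) (q.rootSet L) :=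
    { smul := fun g => Set.MapsTo.restrict g _ _ (rootSet_mapsTo g.toAlgHom)
      one_smul := fun _ => rfl
      mul_smul := fun _ _ _ => rfl }
  have htrans : MulAction.IsPretransitive (L ≃ₐ[ℚ] L) (q.rootSet L) := by
    refine ⟨fun x y => ?_⟩
    have hx := minpoly.eq_of_irreducible hq (mem_rootSet.1 x.2).2
    have hy := minpoly.eq_of_irreducible hq (mem_rootSet.1 y.2).2
    obtain ⟨g, hg⟩ := (Normal.minpoly_eq_iff_mem_orbit L).1 (hy.symm.trans hx)
    exact ⟨g, Subtype.ext hg⟩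
  have hzero : ∀ i j, i ≠ j → w i ⬝ᵥ (T.map (Int.castRingHom (𝓞 L))).mulVec (u j) = 0 := by
    intro i j hij
    obtain ⟨g, hgi, hgj⟩ := exists_smul_mem_and_notMem (G := L ≃ₐ[ℚ] L) Z
      (by rw [hcard, ← hZ, hgcd]) hij.symm
    -- The preimage of P under σ contains r_i but not r_j, since g moves i into Z and j out of it.
    let σ : 𝓞 L ≃+* 𝓞 L := RingOfIntegers.mapRingEquiv g.toRingEquiv
    have hσ : ∀ k, σ (r k) = r (g • k) := fun k => rfl
    refine dotProduct_mulVec_eq_zero hT (P.comap (σ : 𝓞 L →+* 𝓞 L)) (l := r j) (m := r i)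
      ?_ ?_ (hu' j) (hw' i)
    · exact fun h => hgj (Finset.mem_filter.2 ⟨Finset.mem_univ _, h⟩)
    · exact (Finset.mem_filter.1 hgi).2
  let e : Fin n ≃ q.rootSet L := (Fintype.equivFinOfCardEq hcard).symm
  have hcomm := commute_of_dotProduct_eq_zero (A := A') (T := T.map (Int.castRingHom (𝓞 L)))
    (l := r ∘ e) (hr.comp e.injective) (U := u ∘ e) (W := w ∘ e) (fun i => hu0 _)
    (fun i => hw0 _) (fun i => hu' _) (fun i => hw' _)
    (fun i j hij => hzero _ _ (e.injective.ne hij))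
  apply Matrix.map_injective (Int.castRingHom (𝓞 L)).injective_int
  simpa only [Matrix.map_mul] using hcomm.eq

open Polynomial in
theorem commute_of_continuousFor {A T : Matrix (Fin n) (Fin n) ℤ} (hirr : Irreducible A.charpoly)
    {p : ℕ} (hp : p.Prime) (hgcd : Nat.gcd n (zeroMult A p) = 1) (hT : ContinuousFor A T) :
    Commute T A := by
  let q : ℚ[X] := A.charpoly.map (algebraMap ℤ ℚ)
  have : NumberField q.SplittingField :=
    { to_charZero := inferInstance, to_finiteDimensional := inferInstance }
  exact @commute_of_continuousFor_of_splits n q.SplittingField _ _ _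
    (SplittingField.instNormal q) A T hirr (SplittingField.splits q) p hp hgcd hT

/-! ### The centralizer as a group of units -/

open Polynomial in
theorem charpoly_dvd_iff_aeval_eq_zero {A : Matrix (Fin n) (Fin n) ℚ} (hirr : Irreducible A.charpoly)
    {f : ℚ[X]} {v : Fin n → ℚ} (hv : v ≠ 0) :
    (aeval A f).mulVec v = 0 ↔ A.charpoly ∣ f := by
  refine ⟨fun h => ?_, ?_⟩
  · by_contra hdvd
    obtain ⟨a, b, hab⟩ := ((hirr.coprime_iff_not_dvd).2 hdvd)
    have h1 := congrArg (fun g => (aeval A g).mulVec v) hab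
    simp only [map_add, map_mul, Matrix.aeval_self_charpoly, mul_zero, zero_add, map_one,
      Matrix.one_mulVec, ← Matrix.mulVec_mulVec, h, Matrix.mulVec_zero] at h1
    exact hv h1.symm
  · rintro ⟨g, rfl⟩
    simp [Matrix.aeval_self_charpoly]

open Polynomial in
/-- A matrix with irreducible characteristic polynomial is centralized only by polynomials
in it. -/
theorem exists_eq_aeval_of_commute {A T : Matrix (Fin n) (Fin n) ℚ}
    (hirr : Irreducible A.charpoly) (h : Commute T A) : ∃ f : ℚ[X], T = aeval A f := by
  have hn : n ≠ 0 := fun h0 => hirr.not_isUnit (by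
    subst h0; simp [Matrix.charpoly])
  have : NeZero n := ⟨hn⟩
  -- Any nonzero vector is cyclic, by irreducibility. Writing Tv = f(A)v, the difference T - f(A)
  -- commutes with A, so it kills the basis A^k v.
  let v : Fin n → ℚ := Pi.single 0 1
  have hv : v ≠ 0 := by simp [v]
  let b : Fin n → (Fin n → ℚ) := fun k => (A ^ (k : ℕ)).mulVec v
  have hsum : ∀ c : Fin n → ℚ, (aeval A (∑ k, C (c k) * X ^ (k : ℕ))).mulVec v = ∑ k, c k • b k :=
    fun c => by
      simp only [map_sum, map_mul, aeval_C, map_pow, aeval_X, Matrix.sum_mulVec, b,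
        ← Algebra.smul_def, Matrix.smul_mulVec]
  have hli : LinearIndependent ℚ b := Fintype.linearIndependent_iff.2 fun c hc k => by
    rw [← hsum, charpoly_dvd_iff_aeval_eq_zero hirr hv] at hc
    have h0 := eq_zero_of_dvd_of_degree_lt hc (by
      rw [A.charpoly_degree_eq_dim, Fintype.card_fin]
      refine (degree_sum_le _ _).trans_lt ((Finset.sup_lt_iff (WithBot.bot_lt_coe n)).2
        fun i _ => (degree_C_mul_X_pow_le _ _).trans_lt (Nat.cast_lt.2 i.2)))
    have h1 := congrArg (fun g => g.coeff k) h0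
    simpa [finsetSum_coeff, coeff_C_mul, coeff_X_pow, Fin.val_inj] using h1
  have hmem : T.mulVec v ∈ Submodule.span ℚ (Set.range b) := by
    rw [hli.span_eq_top_of_card_eq_finrank (by simp)]
    trivial
  obtain ⟨c, hc⟩ := (Submodule.mem_span_range_iff_exists_fun ℚ).1 hmem
  refine ⟨∑ k, C (c k) * X ^ (k : ℕ), ?_⟩
  rw [← hsum] at hc
  set f := ∑ k, C (c k) * X ^ (k : ℕ)
  have hcomm : ∀ k : ℕ, (T - aeval A f) * A ^ k = A ^ k * (T - aeval A f) := fun k => by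
    have h1 : Commute (aeval A f) A := by
      simpa using (Commute.all f X).map (aeval A)
    exact ((h.sub_left h1).pow_right k).eq
  have hzero : ∀ k, (T - aeval A f).mulVec (b k) = 0 := fun k => by
    rw [Matrix.mulVec_mulVec, hcomm, ← Matrix.mulVec_mulVec, Matrix.sub_mulVec, hc, sub_self,
      Matrix.mulVec_zero]
  refine sub_eq_zero.1 (Matrix.mulVec_injective (funext fun x => ?_))
  have hx : x ∈ Submodule.span ℚ (Set.range b) := by
    rw [hli.span_eq_top_of_card_eq_finrank (by simp)]
    trivial
  obtain ⟨d, rfl⟩ := (Submodule.mem_span_range_iff_exists_fun ℚ).1 hx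
  simp [Matrix.mulVec_sum, Matrix.mulVec_smul, hzero]

-- A and l have the same minimal polynomial over ℚ, namely the irreducible characteristic
-- polynomial.
open Polynomial in
theorem aeval_eq_zero_iff_of_aeval_charpoly {A : Matrix (Fin n) (Fin n) ℚ}
    (hirr : Irreducible A.charpoly) {K : Type*} [Field K] [Algebra ℚ K] {l : K}
    (hl : aeval l A.charpoly = 0) (f : ℚ[X]) : aeval A f = 0 ↔ aeval l f = 0 := by
  have hn : n ≠ 0 := fun h0 => hirr.not_isUnit (by
    subst h0; simp [Matrix.charpoly])
  have : NeZero n := ⟨hn⟩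
  rw [← minpoly.dvd_iff, ← minpoly.dvd_iff,
    ← minpoly.eq_of_irreducible_of_monic hirr hl A.charpoly_monic,
    ← minpoly.eq_of_irreducible_of_monic hirr A.aeval_self_charpoly A.charpoly_monic]

open Polynomial NumberField in
/-- The centralizer of a matrix with irreducible characteristic polynomial embeds in the unit group
of any number field containing a root. -/
theorem exists_injective_hom_units {A : Matrix (Fin n) (Fin n) ℤ}
    (hirr : Irreducible A.charpoly) (N : Subgroup (Matrix.GeneralLinearGroup (Fin n) ℤ))
    (hN : ∀ T ∈ N, Commute (T : Matrix (Fin n) (Fin n) ℤ) A)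
    {K : Type*} [Field K] [Algebra ℚ K] {l : K} (hl : aeval l A.charpoly = 0) :
    ∃ F : N →* (𝓞 K)ˣ, Function.Injective F := by
  let A' := A.map (Int.castRingHom ℚ)
  have hchar : A'.charpoly = A.charpoly.map (algebraMap ℤ ℚ) := A.charpoly_map _
  have hirr' : Irreducible A'.charpoly :=
    hchar ▸ A.charpoly_monic.irreducible_iff_irreducible_map_fraction_map.1 hirr
  have hl' : aeval l A'.charpoly = 0 := by rwa [hchar, aeval_map_algebraMap]
  let φ : Matrix (Fin n) (Fin n) ℤ →+* Matrix (Fin n) (Fin n) ℚ := (Int.castRingHom ℚ).mapMatrix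
  have hφ : Function.Injective φ := Matrix.map_injective (Int.castRingHom ℚ).injective_int
  have hex : ∀ T : N, ∃ f : ℚ[X], φ T.1.1 = aeval A' f := fun T =>
    exists_eq_aeval_of_commute hirr' ((hN T.1 T.2).map φ)
  choose f hf using hex
  -- This makes T ↦ f_T(l) multiplicative and injective, although the polynomials f_T are arbitrary
  -- choices.
  have key : ∀ {g g' : ℚ[X]}, aeval A' g = aeval A' g' ↔ aeval l g = aeval l g' := fun {g g'} => by
    rw [← sub_eq_zero, ← map_sub, aeval_eq_zero_iff_of_aeval_charpoly hirr' hl', map_sub,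
      sub_eq_zero]
  -- f_T(l) is a root of the monic integral characteristic polynomial of `T`: Cayley–Hamilton,
  -- transferred from A to l.
  have hint : ∀ T : N, IsIntegral ℤ (aeval l (f T)) := fun T => by
    refine ⟨T.1.1.charpoly, T.1.1.charpoly_monic, ?_⟩
    have h1 : aeval A' ((T.1.1.charpoly.map (algebraMap ℤ ℚ)).comp (f T)) = 0 := by
      rw [aeval_comp, ← hf, ← T.1.1.charpoly_map]
      exact Matrix.aeval_self_charpoly _
    rw [aeval_eq_zero_iff_of_aeval_charpoly hirr' hl', aeval_comp, aeval_map_algebraMap] at h1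
    exact h1
  let F : N →* 𝓞 K :=
    { toFun := fun T => ⟨aeval l (f T), hint T⟩
      map_one' := RingOfIntegers.ext (by
        change aeval l (f 1) = 1
        rw [← map_one (aeval (R := ℚ) l), ← key, ← hf, map_one]
        exact map_one φ)
      map_mul' := fun S T => RingOfIntegers.ext (by
        change aeval l (f (S * T)) = aeval l (f S) * aeval l (f T)
        rw [← map_mul, ← key, map_mul, ← hf, ← hf, ← hf]
        exact map_mul φ _ _) }
  refine ⟨F.toHomUnits, fun S T h => ?_⟩
  have h1 : aeval l (f S) = aeval l (f T) :=
    congrArg (fun x : (𝓞 K)ˣ => ((x : 𝓞 K) : K)) h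
  rw [← key, ← hf, ← hf] at h1
  exact Subtype.ext (Units.ext (hφ h1))

/-! ### Finiteness properties from Dirichlet's unit theorem -/

theorem group_fg_of_injective {G H : Type*} [Group G] [CommGroup H] [Monoid.FG H] (F : G →* H)
    (hF : Function.Injective F) : Group.FG G := by
  have : Group.FG H := Group.fg_iff_monoid_fg.2 ‹_›
  have h1 : AddGroup.FG (Additive H) := GroupFG.iff_add_fg.1 ‹_›
  have h2 : Module.Finite ℤ (Additive H) := Module.Finite.iff_addGroup_fg.2 h1
  have h3 : Module.Finite ℤ (AddSubgroup.toIntSubmodule F.range.toAddSubgroup) := inferInstance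
  have h4 : AddGroup.FG F.range.toAddSubgroup := Module.Finite.iff_addGroup_fg.1 h3
  have h5 : Group.FG F.range := GroupFG.iff_add_fg.2 h4
  exact Group.fg_of_surjective (f := (MonoidHom.ofInjective hF).symm.toMonoidHom)
    (MonoidHom.ofInjective hF).symm.surjective

open NumberField in
theorem finite_units_of_rank_eq_zero (K : Type*) [Field K] [NumberField K]
    (h : Units.rank K = 0) : Finite (𝓞 K)ˣ := by
  have : IsEmpty (Fin (Units.rank K)) := h ▸ Fin.isEmpty
  refine Finite.of_surjective (Subtype.val : Units.torsion K → (𝓞 K)ˣ) fun x => ?_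
  obtain ⟨⟨ζ, e⟩, hx, -⟩ := Units.exist_unique_eq_mul_prod K x
  exact ⟨ζ, by simpa using hx.symm⟩

-- With no real places, r₁ + 2r₂ = 2 forces r₂ = 1, and the rank is r₁ + r₂ - 1 = 0.
open NumberField in
theorem rank_eq_zero_of_finrank_eq_two (K : Type*) [Field K] [NumberField K]
    (h2 : Module.finrank ℚ K = 2) (hK : IsEmpty (K →+* ℝ)) : Units.rank K = 0 := by
  have h := InfinitePlace.card_add_two_mul_card_eq_rank K
  have h0 : InfinitePlace.nrRealPlaces K = 0 := by
    classical
    exact Fintype.card_eq_zero_iff.2 ⟨fun w => hK.elim (InfinitePlace.embedding_of_isReal w.2)⟩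
  rw [Units.rank, InfinitePlace.card_eq_nrRealPlaces_add_nrComplexPlaces]
  omega

end ZnOdometer

open ZnOdometer in
theorem mainTheorem7 (n : ℕ) (A : Matrix (Fin n) (Fin n) ℤ) (hA : A.det ≠ 0) :
    ((ZnOdometer.primesDet A = ∅ ∨ ZnOdometer.primesDet' A = ∅) →
      ZnOdometer.linRepGroup A = ⊤) ∧
    ((ZnOdometer.primesDet' A).Nonempty → Irreducible A.charpoly →
      (∃ p : ℕ, p.Prime ∧ Nat.gcd n (ZnOdometer.zeroMult A p) = 1) →
      (∀ T : Matrix.GeneralLinearGroup (Fin n) ℤ, T ∈ ZnOdometer.linRepGroup A ↔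
        (T : Matrix (Fin n) (Fin n) ℤ) * A = A * (T : Matrix (Fin n) (Fin n) ℤ)) ∧
      (∀ l : AlgebraicClosure ℚ,
        Module.End.HasEigenvalue
          (Matrix.toLin' (A.map (Int.castRingHom (AlgebraicClosure ℚ)))) l →
        ∃ H : Subgroup (NumberField.RingOfIntegers (IntermediateField.adjoin ℚ {l}))ˣ,
          Nonempty (ZnOdometer.linRepGroup A ≃* H)) ∧
      (∀ S ∈ ZnOdometer.linRepGroup A, ∀ T ∈ ZnOdometer.linRepGroup A, S * T = T * S) ∧
      Group.FG (ZnOdometer.linRepGroup A) ∧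
      (n = 2 → (∀ x : ℝ, Polynomial.aeval x A.charpoly ≠ 0) →
        Finite (ZnOdometer.linRepGroup A))) := by
  refine ⟨linRepGroup_eq_top hA, fun _ hirr ⟨p, hp, hgcd⟩ => ?_⟩
  have hcomm : ∀ T ∈ linRepGroup A, Commute (T : Matrix (Fin n) (Fin n) ℤ) A := fun T hT =>
    commute_of_continuousFor hirr hp hgcd (continuousFor_of_mem_linRepGroup hT)
  have hirrQ : Irreducible (A.charpoly.map (algebraMap ℤ ℚ)) :=
    A.charpoly_monic.irreducible_iff_irreducible_map_fraction_map.1 hirr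
  have hgen : ∀ l : AlgebraicClosure ℚ, Polynomial.aeval l A.charpoly = 0 →
      Polynomial.aeval (IntermediateField.AdjoinSimple.gen ℚ l) A.charpoly = 0 := fun l hl => by
    apply (algebraMap (IntermediateField.adjoin ℚ {l}) (AlgebraicClosure ℚ)).injective
    rw [← Polynomial.aeval_algebraMap_apply, IntermediateField.AdjoinSimple.algebraMap_gen, hl,
      map_zero]
  obtain ⟨l, hl⟩ : ∃ l : AlgebraicClosure ℚ, Polynomial.aeval l A.charpoly = 0 := by
    obtain ⟨l, hl⟩ := IsAlgClosed.exists_aeval_eq_zero (AlgebraicClosure ℚ)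
      (A.charpoly.map (algebraMap ℤ ℚ)) hirrQ.degree_pos.ne'
    exact ⟨l, by rwa [Polynomial.aeval_map_algebraMap] at hl⟩
  have hlint : IsIntegral ℚ l :=
    ⟨_, A.charpoly_monic.map (algebraMap ℤ ℚ), by
      rwa [← Polynomial.aeval_def, Polynomial.aeval_map_algebraMap]⟩
  have hfin : FiniteDimensional ℚ (IntermediateField.adjoin ℚ {l}) :=
    IntermediateField.adjoin.finiteDimensional hlint
  have : NumberField (IntermediateField.adjoin ℚ {l}) :=
    { to_charZero := inferInstance, to_finiteDimensional := hfin }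
  obtain ⟨F, hF⟩ := exists_injective_hom_units hirr (linRepGroup A) hcomm (hgen l hl)
  refine ⟨fun T => ⟨hcomm T, mem_linRepGroup_of_commute⟩, fun m hm => ?_, fun S hS T hT => ?_,
    group_fg_of_injective F hF, fun h2 hreal => ?_⟩
  · have hm' : Polynomial.aeval m A.charpoly = 0 := by
      rw [Module.End.hasEigenvalue_iff_isRoot_charpoly, Matrix.charpoly_toLin',
        Matrix.charpoly_map, Polynomial.IsRoot.def, Polynomial.eval_map] at hm
      exact hm
    obtain ⟨E, hE⟩ := exists_injective_hom_units hirr (linRepGroup A) hcomm (hgen m hm')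
    exact ⟨E.range, ⟨MonoidHom.ofInjective hE⟩⟩
  · exact congrArg Subtype.val
      (hF (by rw [map_mul, map_mul, mul_comm]) :
        (⟨S, hS⟩ * ⟨T, hT⟩ : linRepGroup A) = ⟨T, hT⟩ * ⟨S, hS⟩)
  · have hmin : A.charpoly.map (algebraMap ℤ ℚ) = minpoly ℚ l :=
      minpoly.eq_of_irreducible_of_monic hirrQ (by rwa [Polynomial.aeval_map_algebraMap])
        (A.charpoly_monic.map _)
    have hrank : Module.finrank ℚ (IntermediateField.adjoin ℚ {l}) = 2 := by
      rw [IntermediateField.adjoin.finrank hlint, ← hmin, A.charpoly_monic.natDegree_map,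
        A.charpoly_natDegree_eq_dim, Fintype.card_fin, h2]
    -- A real embedding would send l to a real root of h_A.
    have hempty : IsEmpty (IntermediateField.adjoin ℚ {l} →+* ℝ) := ⟨fun σ => by
      apply hreal (σ (IntermediateField.AdjoinSimple.gen ℚ l))
      have h := congrArg σ (hgen l hl)
      rwa [Polynomial.aeval_def, Polynomial.hom_eval₂, map_zero,
        RingHom.ext_int (σ.comp (algebraMap ℤ _)) (algebraMap ℤ ℝ)] at h⟩
    have := finite_units_of_rank_eq_zero _ (rank_eq_zero_of_finrank_eq_two _ hrank hempty)
    exact Finite.of_injective F hF
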